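/- Let $(\Omega,\mathcal F,\mathbb P)$ be a probability space and let $L^0$ be the space of real random variables modulo almost-sure equality. A linear subspace $\mathcal L\subset L^0$ with $L^\infty\subset\mathcal L\subset L^1$ that is a Banach lattice for the almost-sure order is called admissible; put $\mathcal L'=\{Z\in L^0:\mathbb E|XZ|<\infty\ \forall X\in\mathcal L\}$. We say that $\mathcal L'$ is the norm dual of $\mathcal L$ if the norm-continuous linear functionals on $\mathcal L$ are exactly the functionals $X\mapsto\mathbb E[XZ]$ with $Z\in\mathcal L'$. Let $d\ge1$, let $\mathcal X_1,\dots,\mathcal X_d,\mathcal E$ be admissible, $\mathcal X=\mathcal X_1\times\cdots\times\mathcal X_d$ (with the componentwise order and the product norm), $\mathcal X'=\mathcal X_1'\times\cdots\times\mathcal X_d'$, and let $\sigma(\mathcal X,\mathcal X')$ be the coarsest topology on $\mathcal X$ making all functionals $X\mapsto\sum_{i=1}^d\mathbb E[X_iZ_i]$, $Z\in\mathcal X'$, continuous; define $\sigma(\mathcal E,\mathcal E')$ likewise. Regard $\mathbb R^d\subset\mathcal X$ and $\mathbb R\subset\mathcal E$ as the constants. Let $S:\mathcal X\to\mathcal E$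 be nonconstant, nondecreasing and concave, with $S(0)=0$ and with $X\mapsto\mathbb E[S(X)W]$ $\sigma(\mathcal X,\mathcal X')$-upper semicontinuous for every $0\le W\in\mathcal E'$. Let $\mathcal A\subset\mathcal E$ be convex and $\sigma(\mathcal E,\mathcal E')$-closed, with $0\in\mathcal A$, $\mathcal A+\mathcal E_+\subset\mathcal A$, and with $S^{-1}(\mathcal A)$ a nonempty proper subset of $\mathcal X$. Define $\rho:\mathcal X\to[-\infty,\infty]$ by $$\rho(X)=\inf\Big\{\sum_{i=1}^d m_i:\ m\in\mathbb R^d,\ S(X+m)\in\mathcal A\Big\},\qquad \inf\emptyset=\infty .$$ Call $\rho$ proper if it never takes the value $-\infty$ and is finite at some point. Let $\mathcal M_0=\{m\in\mathbb R^d:\sum_{i=1}^d m_i=0\}$. Then: (i) If $\Omega$ is finite and $\rho(0)>-\infty$, then $\rho$ is finite valued and continuous (for the norm topology and for $\sigma(\mathcal X,\mathcal X')$). (ii) If $\mathcal X_i'$ is the norm dual of $\mathcal X_i$ for every $i$ and $\rho$ is finite valued, then $\rho$ is $\sigma(\mathcal X,\mathcal X')$-lower semicontinuous. (iii) If $\mathcal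 X_i'$ is the norm dual of $\mathcal X_i$ for every $i$, $S^{-1}(\mathcal A)$ has nonempty interior in the norm topology and $\rho(0)>-\infty$, then $\rho$ is finite valued and $\sigma(\mathcal X,\mathcal X')$-lower semicontinuous. (iv) If $S^{-1}(\mathcal A)\cap\mathcal M_0=\{0\}$, then $\rho$ is proper and $\sigma(\mathcal X,\mathcal X')$-lower semicontinuous. (v) If $\mathcal A\cap\mathbb R_-=\{0\}$ and, for every nonzero $m\in\mathcal M_0$, $S(m)$ is (almost surely equal to) a constant in $(-\infty,0)$, then $\rho$ is proper and $\sigma(\mathcal X,\mathcal X')$-lower semicontinuous. -/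

import Mathlib

open MeasureTheory Filter Topology
open scoped ENNReal

noncomputable section

namespace SystemicRisk

variable {Ω : Type*} [MeasurableSpace Ω]

/-- An admissible space of random variables: a linear subspace of `L⁰` that contains `L^∞`, is
contained in `L¹` and is a Banach lattice for the almost-sure order (the norm is part of the data;
the lattice operations are the almost-sure ones). -/
structure AdmissibleSpace (P : Measure Ω) where
  /-- the underlying subspace of `L⁰` -/
  space : Submodule ℝ (Ω →ₘ[P] ℝ)
  /-- the norm -/
  nrm : Seminorm ℝ space
  eq_zero_of_nrm : ∀ X : space, nrm X = 0 → X = 0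
  sup_mem : ∀ X Y : Ω →ₘ[P] ℝ, X ∈ space → Y ∈ space → X ⊔ Y ∈ space
  solid : ∀ X Y : space, |(X : Ω →ₘ[P] ℝ)| ≤ |(Y : Ω →ₘ[P] ℝ)| → nrm X ≤ nrm Y
  complete : ∀ u : ℕ → space,
    (∀ ε : ℝ, 0 < ε → ∃ N : ℕ, ∀ m ≥ N, ∀ n ≥ N, nrm (u m - u n) < ε) →
    ∃ X : space, Tendsto (fun n => nrm (u n - X)) atTop (𝓝 0)
  bounded_mem : ∀ X : Ω →ₘ[P] ℝ, MemLp X ∞ P → X ∈ space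
  integrable : ∀ X : Ω →ₘ[P] ℝ, X ∈ space → Integrable X P

namespace AdmissibleSpace

variable {P : Measure Ω}

instance (L : AdmissibleSpace P) : Norm L.space := ⟨fun X => L.nrm X⟩

theorem core (L : AdmissibleSpace P) : NormedSpace.Core ℝ L.space where
  norm_nonneg X := apply_nonneg L.nrm X
  norm_smul c X := map_smul_eq_mul L.nrm c X
  norm_triangle X Y := map_add_le_add L.nrm X Y
  norm_eq_zero_iff X := ⟨L.eq_zero_of_nrm X, fun h => by subst h; exact map_zero L.nrm⟩

instance (L : AdmissibleSpace P) : NormedAddCommGroup L.space := NormedAddCommGroup.ofCore L.core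

instance (L : AdmissibleSpace P) : NormedSpace ℝ L.space := NormedSpace.ofCore L.core

/-- The dual space `L' = {Z ∈ L⁰ ; E[|XZ|] < ∞ for all X ∈ L}`. -/
def dual (L : AdmissibleSpace P) : Submodule ℝ (Ω →ₘ[P] ℝ) where
  carrier := {Z | ∀ X : L.space, Integrable (fun ω => (X : Ω →ₘ[P] ℝ) ω * Z ω) P}
  zero_mem' X := by
    refine (integrable_zero Ω ℝ P).congr ?_
    filter_upwards [AEEqFun.coeFn_zero (μ := P) (α := Ω) (β := ℝ)] with ω h
    simp [h]
  add_mem' {Y Z} hY hZ X := by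
    refine ((hY X).add (hZ X)).congr ?_
    filter_upwards [AEEqFun.coeFn_add Y Z] with ω h
    simp [h, mul_add]
  smul_mem' c Z hZ X := by
    refine ((hZ X).const_mul c).congr ?_
    filter_upwards [AEEqFun.coeFn_smul c Z] with ω h
    simp only [h, Pi.smul_apply, smul_eq_mul]
    ring

/-- The bilinear form `(X, Z) ↦ E[XZ]` on `L × L'`. -/
def pairing (L : AdmissibleSpace P) : L.space →ₗ[ℝ] L.dual →ₗ[ℝ] ℝ :=
  LinearMap.mk₂ ℝ (fun X Z => ∫ ω, (X : Ω →ₘ[P] ℝ) ω * (Z : Ω →ₘ[P] ℝ) ω ∂P)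
    (fun X Y Z => by
      rw [← integral_add (Z.2 X) (Z.2 Y)]
      refine integral_congr_ae ?_
      filter_upwards [AEEqFun.coeFn_add (X : Ω →ₘ[P] ℝ) Y] with ω h
      simp [h, add_mul])
    (fun c X Z => by
      rw [smul_eq_mul, ← integral_const_mul]
      refine integral_congr_ae ?_
      filter_upwards [AEEqFun.coeFn_smul c (X : Ω →ₘ[P] ℝ)] with ω h
      simp [h, mul_assoc])
    (fun X Y Z => by
      rw [← integral_add (Y.2 X) (Z.2 X)]
      refine integral_congr_ae ?_
      filter_upwards [AEEqFun.coeFn_add (Y : Ω →ₘ[P] ℝ) Z] with ω h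
      simp [h, mul_add])
    (fun c X Z => by
      rw [smul_eq_mul, ← integral_const_mul]
      refine integral_congr_ae ?_
      filter_upwards [AEEqFun.coeFn_smul c (Z : Ω →ₘ[P] ℝ)] with ω h
      simp only [SetLike.val_smul, h, Pi.smul_apply, smul_eq_mul]
      ring)

/-- `L'` is the norm dual of `L`: the norm-continuous linear functionals on `L` are exactly the
functionals `X ↦ E[XZ]` with `Z ∈ L'`. -/
def DualIsNormDual (L : AdmissibleSpace P) : Prop :=
  ∀ φ : L.space →ₗ[ℝ] ℝ, Continuous φ ↔ ∃ Z : L.dual, ∀ X : L.space, φ X = L.pairing X Z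

/-- The constant random variable `c`, as an element of `L`. -/
def const [IsFiniteMeasure P] (L : AdmissibleSpace P) (c : ℝ) : L.space :=
  ⟨AEEqFun.const Ω c, L.bounded_mem _ <|
    (memLp_congr_ae (AEEqFun.coeFn_const Ω c)).2 (memLp_const c)⟩

end AdmissibleSpace

variable {P : Measure Ω} {d : ℕ}

/-- The space `𝓧 = 𝓧₁ × ⋯ × 𝓧_d` of `d`-dimensional random vectors, with the product order and the
product norm. -/
abbrev Vec (𝓧 : Fin d → AdmissibleSpace P) : Type _ := ∀ i, (𝓧 i).space

/-- The dual space `𝓧' = 𝓧₁' × ⋯ × 𝓧_d'`. -/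
abbrev VecDual (𝓧 : Fin d → AdmissibleSpace P) : Type _ := ∀ i, (𝓧 i).dual

/-- The bilinear form `(X | Z) = ∑ i, E[X_i Z_i]` on `𝓧 × 𝓧'`. -/
def vecPairing (𝓧 : Fin d → AdmissibleSpace P) : Vec 𝓧 →ₗ[ℝ] VecDual 𝓧 →ₗ[ℝ] ℝ :=
  LinearMap.mk₂ ℝ (fun X Z => ∑ i, (𝓧 i).pairing (X i) (Z i))
    (fun X Y Z => by simp [Finset.sum_add_distrib])
    (fun c X Z => by simp [Finset.mul_sum])
    (fun X Y Z => by simp [Finset.sum_add_distrib])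
    (fun c X Z => by simp [Finset.mul_sum])

/-- `𝓧` with the topology `σ(𝓧, 𝓧')`. -/
abbrev WeakVec (𝓧 : Fin d → AdmissibleSpace P) : Type _ := WeakBilin (vecPairing 𝓧)

/-- The embedding of `ℝ^d` into `𝓧` as constant random vectors. -/
def constVec [IsFiniteMeasure P] (𝓧 : Fin d → AdmissibleSpace P) (m : Fin d → ℝ) : Vec 𝓧 :=
  fun i => (𝓧 i).const (m i)

/-- Admissible impact maps `S : 𝓧 → 𝓔`. -/
structure IsAdmissibleImpact (𝓧 : Fin d → AdmissibleSpace P) (𝓔 : AdmissibleSpace P)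
    (S : Vec 𝓧 → 𝓔.space) : Prop where
  not_constant : ∃ X Y : Vec 𝓧, S X ≠ S Y
  map_zero : S 0 = 0
  mono : ∀ X Y : Vec 𝓧, Y ≤ X → S Y ≤ S X
  concave : ∀ (X Y : Vec 𝓧) (t : ℝ), 0 ≤ t → t ≤ 1 →
    t • S X + (1 - t) • S Y ≤ S (t • X + (1 - t) • Y)
  usc : ∀ W : 𝓔.dual, 0 ≤ W →
    UpperSemicontinuous (α := WeakVec 𝓧) (fun X => 𝓔.pairing (S X) W)

/-- Admissible acceptance sets `𝓐 ⊆ 𝓔` (relative to the impact map `S`). -/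
structure IsAdmissibleAcceptance (𝓧 : Fin d → AdmissibleSpace P) (𝓔 : AdmissibleSpace P)
    (S : Vec 𝓧 → 𝓔.space) (𝓐 : Set 𝓔.space) : Prop where
  nonempty : (S ⁻¹' 𝓐).Nonempty
  proper : S ⁻¹' 𝓐 ≠ Set.univ
  zero_mem : (0 : 𝓔.space) ∈ 𝓐
  mono : ∀ U ∈ 𝓐, ∀ V : 𝓔.space, 0 ≤ V → U + V ∈ 𝓐
  convex : Convex ℝ 𝓐
  closed : IsClosed (X := WeakBilin 𝓔.pairing) 𝓐

/-- The systemic risk measure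
`ρ(X) = inf {∑ i, m_i ; m ∈ ℝ^d, S(X + m) ∈ 𝓐}`, with values in `[-∞, ∞]` and `inf ∅ = ∞`. -/
def rho [IsFiniteMeasure P] (𝓧 : Fin d → AdmissibleSpace P) (𝓔 : AdmissibleSpace P)
    (S : Vec 𝓧 → 𝓔.space) (𝓐 : Set 𝓔.space) (X : Vec 𝓧) : EReal :=
  sInf {r : EReal | ∃ m : Fin d → ℝ, S (X + constVec 𝓧 m) ∈ 𝓐 ∧ r = ((∑ i, m i : ℝ) : EReal)}

/-- The subspace `𝓜₀ = {m ∈ ℝ^d ; ∑ i, m_i = 0}`, viewed inside `𝓧`. -/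
def M0 [IsFiniteMeasure P] (𝓧 : Fin d → AdmissibleSpace P) : Set (Vec 𝓧) :=
  constVec 𝓧 '' {m | ∑ i, m i = 0}

/-- An extended-real-valued map is finite valued if it takes neither of the values `±∞`. -/
def FiniteValued {α : Type*} (f : α → EReal) : Prop := ∀ x, f x ≠ ⊥ ∧ f x ≠ ⊤

/-- An extended-real-valued map is proper if it never takes the value `-∞` and is finite at some
point. -/
def IsProper {α : Type*} (f : α → EReal) : Prop := (∀ x, f x ≠ ⊥) ∧ ∃ x, f x ≠ ⊤

end SystemicRisk

end

/-! ### Order and norm: automatic boundedness of monotone functions, closed positive cones. -/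

noncomputable section

/-! Everything is about `C = S ⁻¹' 𝓐`, a proper convex upper set containing `0`. It is weakly closed
(`isClosed_preimage`), although `S` is only scalarly upper semicontinuous. The risk measure is the
capital requirement `capital C`.

Finite values give a convex antitone function on a Banach lattice, and such a function is norm
continuous: a series argument bounds it above near `0`, and convexity does the rest. If `𝓧'` is the
norm dual, its norm-closed convex sublevel sets are weakly closed, which is (ii). For finiteness, a
value other than `-∞` at `0` excludes `-∞` everywhere by convexity. The value `+∞` is excluded by
constants dominating every vector when `Ω` is finite, and under (iii) by separating `Y + ℝ^d` from
the interior of `C`: the functional would be positive up to sign and vanish on constants, hence be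
zero.

For (iv), suppose `x + k ∈ C` with `x` convergent and `k ∈ 𝓜₀` unbounded. Dividing by `‖k‖` produces
a unit vector of `𝓜₀` in `C`, which is impossible (`not_tendsto_norm_atTop`). So near-optimal
allocations of fixed total stay bounded, and compactness gives lower semicontinuity; the value `-∞`
would create unbounded ones. Case (v) reduces to (iv). -/

/-- An antitone real function on a complete ordered normed space with closed positive cone, in which
every element dominates the negative of a positive one of no larger norm, is bounded above near `0`. -/
theorem Antitone.isBoundedUnder_nhds_zero {V : Type*} [NormedAddCommGroup V] [NormedSpace ℝ V]
    [CompleteSpace V] [PartialOrder V] [IsOrderedAddMonoid V] (hcl : IsClosed {x : V | 0 ≤ x})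
    (habs : ∀ x : V, ∃ y, 0 ≤ y ∧ -y ≤ x ∧ ‖y‖ ≤ ‖x‖) {f : V → ℝ} (hf : Antitone f) :
    (𝓝 (0 : V)).IsBoundedUnder (· ≤ ·) f := by
  by_contra hcon
  -- Choose `x n` summably small with `f (x n) > n`. The single element `-∑ y (x k)` lies below
  -- every `x n`, so `f` there would exceed every `n`.
  have key : ∀ n : ℕ, ∃ x : V, ‖x‖ < (1 / 2 : ℝ) ^ n ∧ (n : ℝ) < f x := by
    intro n
    by_contra! h
    refine hcon ⟨n, ?_⟩
    rw [eventually_map]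
    filter_upwards [Metric.ball_mem_nhds (0 : V) (pow_pos (by norm_num : (0 : ℝ) < 1 / 2) n)]
      with x hx
    exact h x (by simpa using hx)
  choose x hx hfx using key
  choose y hy0 hyx hyn using habs
  have hsum : Summable fun n => y (x n) :=
    Summable.of_norm_bounded (summable_geometric_of_lt_one (by norm_num) (by norm_num))
      fun n => (hyn _).trans (hx n).le
  have hle : ∀ n, y (x n) ≤ ∑' k, y (x k) := by
    intro n
    have hlim : Tendsto (fun N => ∑ k ∈ Finset.range N, y (x k) - y (x n)) atTop
        (𝓝 (∑' k, y (x k) - y (x n))) := hsum.hasSum.tendsto_sum_nat.sub_const _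
    refine sub_nonneg.1 (hcl.mem_of_tendsto hlim ?_)
    filter_upwards [eventually_gt_atTop n] with N hN
    exact sub_nonneg.2 (Finset.single_le_sum (f := fun k => y (x k)) (fun k _ => hy0 _)
      (Finset.mem_range.2 hN))
  obtain ⟨n, hn⟩ := exists_nat_gt (f (-∑' k, y (x k)))
  have h1 : f (x n) ≤ f (-∑' k, y (x k)) := hf ((neg_le_neg (hle n)).trans (hyx _))
  linarith [hfx n]

namespace SystemicRisk

variable {Ω : Type*} [MeasurableSpace Ω] {P : Measure Ω} {d : ℕ}

namespace AdmissibleSpace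

instance isOrderedAddMonoid (L : AdmissibleSpace P) : IsOrderedAddMonoid L.space where
  add_le_add_left X Y h Z := by
    have h' : (X : Ω →ₘ[P] ℝ) ≤ Y := h
    change (X : Ω →ₘ[P] ℝ) + Z ≤ Y + Z
    rw [← AEEqFun.coeFn_le] at h' ⊢
    filter_upwards [h', AEEqFun.coeFn_add (X : Ω →ₘ[P] ℝ) Z,
      AEEqFun.coeFn_add (Y : Ω →ₘ[P] ℝ) Z] with ω h1 h2 h3
    rw [h2, h3]
    simpa using h1

theorem le_iff (L : AdmissibleSpace P) {X Y : L.space} :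
    X ≤ Y ↔ ∀ᵐ ω ∂P, (X : Ω →ₘ[P] ℝ) ω ≤ (Y : Ω →ₘ[P] ℝ) ω :=
  (AEEqFun.coeFn_le (f := (X : Ω →ₘ[P] ℝ)) (g := Y)).symm

theorem nonneg_iff (L : AdmissibleSpace P) {X : L.space} :
    0 ≤ X ↔ ∀ᵐ ω ∂P, 0 ≤ (X : Ω →ₘ[P] ℝ) ω := by
  rw [L.le_iff]
  refine eventually_congr ?_
  filter_upwards [AEEqFun.coeFn_zero (μ := P) (α := Ω) (β := ℝ)] with ω h
  simp [h]

theorem smul_nonneg (L : AdmissibleSpace P) {c : ℝ} (hc : 0 ≤ c) {X : L.space} (hX : 0 ≤ X) :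
    0 ≤ c • X := by
  rw [L.nonneg_iff] at hX ⊢
  filter_upwards [hX, AEEqFun.coeFn_smul c (X : Ω →ₘ[P] ℝ)] with ω h1 h2
  simpa [h2] using mul_nonneg hc h1

instance completeSpace (L : AdmissibleSpace P) : CompleteSpace L.space := by
  refine Metric.complete_of_cauchySeq_tendsto fun u hu => ?_
  obtain ⟨X, hX⟩ := L.complete u fun ε hε => by
    obtain ⟨N, hN⟩ := Metric.cauchySeq_iff.1 hu ε hε
    exact ⟨N, fun m hm n hn => by
      have h := hN m hm n hn
      rw [dist_eq_norm] at h
      exact h⟩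
  exact ⟨X, tendsto_iff_norm_sub_tendsto_zero.2 hX⟩

theorem coeFn_abs (X : Ω →ₘ[P] ℝ) : ⇑|X| =ᵐ[P] fun ω => |X ω| := by
  filter_upwards [AEEqFun.coeFn_sup X (-X), AEEqFun.coeFn_neg X] with ω h1 h2
  change (X ⊔ -X : Ω →ₘ[P] ℝ) ω = _
  rw [h1, h2]
  rfl

theorem norm_le_of_abs_le (L : AdmissibleSpace P) {X Y : L.space}
    (h : ∀ᵐ ω ∂P, |(X : Ω →ₘ[P] ℝ) ω| ≤ |(Y : Ω →ₘ[P] ℝ) ω|) : ‖X‖ ≤ ‖Y‖ := by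
  refine L.solid X Y ?_
  rw [← AEEqFun.coeFn_le]
  filter_upwards [h, coeFn_abs (X : Ω →ₘ[P] ℝ), coeFn_abs (Y : Ω →ₘ[P] ℝ)] with ω h1 h2 h3
  rwa [h2, h3]

theorem exists_abs (L : AdmissibleSpace P) (X : L.space) :
    ∃ Y : L.space, 0 ≤ Y ∧ -Y ≤ X ∧ ‖Y‖ ≤ ‖X‖ := by
  have hm : (X : Ω →ₘ[P] ℝ) ⊔ -X ∈ L.space := L.sup_mem _ _ X.2 (L.space.neg_mem X.2)
  have hY : ∀ᵐ ω ∂P, ((⟨_, hm⟩ : L.space) : Ω →ₘ[P] ℝ) ω = |(X : Ω →ₘ[P] ℝ) ω| :=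
    coeFn_abs (X : Ω →ₘ[P] ℝ)
  refine ⟨⟨_, hm⟩, ?_, ?_, ?_⟩
  · rw [L.nonneg_iff]
    filter_upwards [hY] with ω h
    rw [h]; exact abs_nonneg _
  · rw [L.le_iff]
    filter_upwards [hY, AEEqFun.coeFn_neg ((X : Ω →ₘ[P] ℝ) ⊔ -X)] with ω h h2
    have h2' : (((-⟨_, hm⟩ : L.space)) : Ω →ₘ[P] ℝ) ω =
      -((⟨_, hm⟩ : L.space) : Ω →ₘ[P] ℝ) ω := h2
    rw [h2', h]
    exact neg_abs_le _
  · refine L.norm_le_of_abs_le ?_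
    filter_upwards [hY] with ω h
    rw [h, abs_abs]

/-- For `Y ≥ 0` the negative part of `X` is at most `|X - Y|`, so solidity makes its norm vanish
when `X` is a limit of such `Y`. -/
theorem isClosed_nonneg (L : AdmissibleSpace P) : IsClosed {X : L.space | 0 ≤ X} := by
  refine isClosed_of_closure_subset fun X hX => ?_
  have hm : (-(X : Ω →ₘ[P] ℝ)) ⊔ 0 ∈ L.space :=
    L.sup_mem _ _ (L.space.neg_mem X.2) L.space.zero_mem
  have hN : ∀ᵐ ω ∂P, ((⟨_, hm⟩ : L.space) : Ω →ₘ[P] ℝ) ω = max (-(X : Ω →ₘ[P] ℝ) ω) 0 := by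
    filter_upwards [AEEqFun.coeFn_sup (-(X : Ω →ₘ[P] ℝ)) 0, AEEqFun.coeFn_neg (X : Ω →ₘ[P] ℝ),
      AEEqFun.coeFn_zero (μ := P) (α := Ω) (β := ℝ)] with ω h1 h2 h3
    rw [h1, h2, h3]
    rfl
  have hle : ‖(⟨_, hm⟩ : L.space)‖ ≤ 0 := by
    refine le_of_forall_pos_lt_add fun ε hε => ?_
    obtain ⟨Y, hY, hd⟩ := Metric.mem_closure_iff.1 hX ε hε
    rw [zero_add]
    refine lt_of_le_of_lt (L.norm_le_of_abs_le ?_) (by rwa [dist_eq_norm] at hd)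
    filter_upwards [hN, L.nonneg_iff.1 hY,
      AEEqFun.coeFn_sub (X : Ω →ₘ[P] ℝ) (Y : Ω →ₘ[P] ℝ)] with ω h1 h2 h3
    have h3' : (((X - Y : L.space)) : Ω →ₘ[P] ℝ) ω =
      (X : Ω →ₘ[P] ℝ) ω - (Y : Ω →ₘ[P] ℝ) ω := h3
    rw [h1, h3', abs_of_nonneg (le_max_right _ _)]
    refine max_le ?_ (abs_nonneg _)
    linarith [neg_abs_le ((X : Ω →ₘ[P] ℝ) ω - (Y : Ω →ₘ[P] ℝ) ω)]
  have h0 : (-(X : Ω →ₘ[P] ℝ)) ⊔ 0 = 0 := congrArg Subtype.val (norm_le_zero_iff.1 hle)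
  change 0 ≤ X
  rw [L.nonneg_iff]
  filter_upwards [hN, AEEqFun.coeFn_zero (μ := P) (α := Ω) (β := ℝ)] with ω h1 h2
  have h1' := h1
  simp only [h0] at h1'
  have h3 : max (-(X : Ω →ₘ[P] ℝ) ω) 0 = 0 := h1'.symm.trans h2
  linarith [le_max_left (-(X : Ω →ₘ[P] ℝ) ω) 0]

end AdmissibleSpace

theorem isClosed_nonneg_vec (𝓧 : Fin d → AdmissibleSpace P) : IsClosed {X : Vec 𝓧 | 0 ≤ X} := by
  have : {X : Vec 𝓧 | 0 ≤ X} = ⋂ i, (fun X : Vec 𝓧 => X i) ⁻¹' {Y | 0 ≤ Y} := by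
    ext X; simp [Pi.le_def]
  rw [this]
  exact isClosed_iInter fun i => (𝓧 i).isClosed_nonneg.preimage (continuous_apply i)

theorem exists_abs_vec (𝓧 : Fin d → AdmissibleSpace P) (X : Vec 𝓧) :
    ∃ Y : Vec 𝓧, 0 ≤ Y ∧ -Y ≤ X ∧ ‖Y‖ ≤ ‖X‖ := by
  choose Y h0 h1 h2 using fun i => (𝓧 i).exists_abs (X i)
  exact ⟨Y, h0, h1, (pi_norm_le_iff_of_nonneg (norm_nonneg X)).2
    fun i => (h2 i).trans (norm_le_pi_norm X i)⟩

end SystemicRisk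

end
-- Duality: separation, positivity of densities, norm-dual case.
noncomputable section

namespace SystemicRisk

/-- A nonnegative quantity bound along a ray forces a nonnegative slope. -/
theorem nonneg_of_forall_le_add_mul {a b c : ℝ} (h : ∀ t : ℝ, 0 ≤ t → c ≤ a + t * b) : 0 ≤ b := by
  by_contra! hb
  -- With this `t`, `t * b = -(|a - c| + 1)`, which pushes `a + t * b` below `c`.
  have h1 := h ((|a - c| + 1) / -b) (by have := neg_pos.2 hb; positivity)
  rw [div_mul_eq_mul_div, div_neg, mul_div_assoc, div_self hb.ne] at h1
  linarith [le_abs_self (a - c)]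

/-- Hahn-Banach separation of a point from a closed convex set for the weak topology of a
bilinear form. -/
theorem exists_separating_of_notMem {E F : Type*} [AddCommGroup E] [Module ℝ E] [AddCommGroup F]
    [Module ℝ F] (B : E →ₗ[ℝ] F →ₗ[ℝ] ℝ) {C : Set E} (hconv : Convex ℝ C)
    (hcl : IsClosed (X := WeakBilin B) C) {x : E} (hx : x ∉ C) :
    ∃ (y : F) (u : ℝ), B x y < u ∧ ∀ a ∈ C, u < B a y := by
  have hloc : LocallyConvexSpace ℝ (WeakBilin B) := inferInstance
  obtain ⟨f, u, h1, h2⟩ := geometric_hahn_banach_point_closed (E := WeakBilin B) (t := C) (x := x)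
    hconv hcl hx
  obtain ⟨y, rfl⟩ := B.dualEmbedding_surjective f
  exact ⟨y, u, h1, h2⟩

variable {Ω : Type*} [MeasurableSpace Ω] {P : Measure Ω} {d : ℕ}

namespace AdmissibleSpace

theorem pairing_apply (L : AdmissibleSpace P) (X : L.space) (Z : L.dual) :
    L.pairing X Z = ∫ ω, (X : Ω →ₘ[P] ℝ) ω * (Z : Ω →ₘ[P] ℝ) ω ∂P := rfl

theorem dual_nonneg_iff (L : AdmissibleSpace P) {Z : L.dual} :
    0 ≤ Z ↔ ∀ᵐ ω ∂P, 0 ≤ (Z : Ω →ₘ[P] ℝ) ω := by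
  rw [show 0 ≤ Z ↔ (0 : Ω →ₘ[P] ℝ) ≤ Z from Iff.rfl, ← AEEqFun.coeFn_le]
  refine eventually_congr ?_
  filter_upwards [AEEqFun.coeFn_zero (μ := P) (α := Ω) (β := ℝ)] with ω h
  simp [h]

/-- The test vector is the indicator of `{Z < 0}`, available because `L` contains all bounded
variables. -/
theorem dual_nonneg_of_pairing (L : AdmissibleSpace P) [IsFiniteMeasure P] {Z : L.dual}
    (h : ∀ V : L.space, 0 ≤ V → 0 ≤ L.pairing V Z) : 0 ≤ Z := by
  have hs : MeasurableSet {ω | (Z : Ω →ₘ[P] ℝ) ω < 0} :=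
    measurableSet_lt (AEEqFun.measurable _) measurable_const
  set s := {ω | (Z : Ω →ₘ[P] ℝ) ω < 0} with hsdef
  have hLp : MemLp (s.indicator fun _ => (1 : ℝ)) ∞ P := (memLp_const 1).indicator hs
  let V : L.space := ⟨AEEqFun.mk _ hLp.1,
    L.bounded_mem _ ((memLp_congr_ae (AEEqFun.coeFn_mk _ _)).2 hLp)⟩
  have hV : ⇑(V : Ω →ₘ[P] ℝ) =ᵐ[P] s.indicator fun _ => (1 : ℝ) := AEEqFun.coeFn_mk _ _
  have hV0 : 0 ≤ V := by
    rw [L.nonneg_iff]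
    filter_upwards [hV] with ω hω
    rw [hω]
    exact Set.indicator_nonneg (fun _ _ => zero_le_one) _
  have hneg : ∀ᵐ ω ∂P, 0 ≤ -((V : Ω →ₘ[P] ℝ) ω * (Z : Ω →ₘ[P] ℝ) ω) := by
    filter_upwards [hV] with ω hω
    rw [hω]
    by_cases hm : ω ∈ s
    · rw [Set.indicator_of_mem hm, one_mul]
      exact neg_nonneg.2 (le_of_lt hm)
    · simp [Set.indicator_of_notMem hm]
  have hint := h V hV0
  rw [L.pairing_apply] at hint
  have hzero : ∫ ω, -((V : Ω →ₘ[P] ℝ) ω * (Z : Ω →ₘ[P] ℝ) ω) ∂P = 0 := by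
    refine le_antisymm ?_ (integral_nonneg_of_ae hneg)
    rw [integral_neg]
    linarith
  rw [integral_eq_zero_iff_of_nonneg_ae hneg (Z.2 V).neg] at hzero
  rw [L.dual_nonneg_iff]
  filter_upwards [hzero, hV] with ω h1 h2
  by_contra! hlt
  rw [h2, Set.indicator_of_mem (show ω ∈ s from hlt)] at h1
  simp at h1
  exact hlt.ne h1

theorem dual_eq_zero_of_pairing (L : AdmissibleSpace P) [IsFiniteMeasure P] {Z : L.dual}
    (h : ∀ V : L.space, 0 ≤ V → 0 ≤ L.pairing V Z) (h1 : L.pairing (L.const 1) Z = 0) :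
    Z = 0 := by
  have hZ := L.dual_nonneg_iff.1 (L.dual_nonneg_of_pairing h)
  have hc : ∀ᵐ ω ∂P, (Z : Ω →ₘ[P] ℝ) ω
      = ((L.const 1 : L.space) : Ω →ₘ[P] ℝ) ω * (Z : Ω →ₘ[P] ℝ) ω := by
    filter_upwards [AEEqFun.coeFn_const (μ := P) Ω (1 : ℝ)] with ω hω
    have hω' : ((L.const 1 : L.space) : Ω →ₘ[P] ℝ) ω = 1 := hω
    rw [hω', one_mul]
  rw [L.pairing_apply, ← integral_congr_ae hc,
    integral_eq_zero_iff_of_nonneg_ae hZ ((Z.2 (L.const 1)).congr (hc.mono fun _ h => h.symm))] at h1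
  exact Subtype.ext (AEEqFun.ext (h1.trans AEEqFun.coeFn_zero.symm))

/-- Pair `X` with its sign: it is bounded, hence in `L'` because `L ⊆ L¹`, and the pairing is
`E|X|`. -/
theorem eq_zero_of_pairing (L : AdmissibleSpace P) [IsFiniteMeasure P] {X : L.space}
    (h : ∀ Z : L.dual, L.pairing X Z = 0) : X = 0 := by
  let g : ℝ → ℝ := fun x => if 0 ≤ x then 1 else -1
  have hLp : AEStronglyMeasurable (fun ω => g ((X : Ω →ₘ[P] ℝ) ω)) P :=
    ((Measurable.ite measurableSet_Ici measurable_const measurable_const).comp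
      (AEEqFun.measurable (X : Ω →ₘ[P] ℝ))).aestronglyMeasurable
  have hb : ∀ x : ℝ, ‖g x‖ ≤ 1 := by
    intro x
    by_cases hx : 0 ≤ x <;> simp [g, hx]
  have hg : ∀ x : ℝ, x * g x = |x| := by
    intro x
    by_cases hx : 0 ≤ x
    · simp [g, hx, abs_of_nonneg hx]
    · simp [g, hx, abs_of_neg (not_le.1 hx)]
  have hmk := AEEqFun.coeFn_mk _ hLp
  let Z : L.dual := ⟨AEEqFun.mk _ hLp, fun Y => by
    refine ((L.integrable _ Y.2).mul_bdd hLp (ae_of_all _ fun ω => hb _)).congr ?_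
    filter_upwards [hmk] with ω hω
    rw [hω]⟩
  have habs : ∀ᵐ ω ∂P, (X : Ω →ₘ[P] ℝ) ω * (Z : Ω →ₘ[P] ℝ) ω = |(X : Ω →ₘ[P] ℝ) ω| := by
    filter_upwards [hmk] with ω hω
    have : (Z : Ω →ₘ[P] ℝ) ω = _ := hω
    rw [this, hg]
  have h0 := h Z
  rw [L.pairing_apply, integral_congr_ae habs, integral_eq_zero_iff_of_nonneg
    (fun _ => abs_nonneg _) (L.integrable _ X.2).abs] at h0
  refine Subtype.ext (AEEqFun.ext (EventuallyEq.trans ?_ AEEqFun.coeFn_zero.symm))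
  filter_upwards [h0] with ω hω
  simpa using hω

end AdmissibleSpace

theorem vecPairing_apply (𝓧 : Fin d → AdmissibleSpace P) (X : Vec 𝓧) (Z : VecDual 𝓧) :
    vecPairing 𝓧 X Z = ∑ i, (𝓧 i).pairing (X i) (Z i) := rfl

theorem vecPairing_single (𝓧 : Fin d → AdmissibleSpace P) (i : Fin d) (X : (𝓧 i).space)
    (Z : VecDual 𝓧) : vecPairing 𝓧 (Pi.single i X) Z = (𝓧 i).pairing X (Z i) := by
  rw [vecPairing_apply, Finset.sum_eq_single i]
  · simp
  · intro j _ hj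
    simp [Pi.single_eq_of_ne hj]
  · simp

/-- The constant random vectors form a linear image of `ℝ^d`. -/
def constVecLin [IsFiniteMeasure P] (𝓧 : Fin d → AdmissibleSpace P) :
    (Fin d → ℝ) →ₗ[ℝ] Vec 𝓧 where
  toFun := constVec 𝓧
  map_add' _ _ := rfl
  map_smul' _ _ := rfl

theorem constVec_single [IsFiniteMeasure P] (𝓧 : Fin d → AdmissibleSpace P) (i : Fin d) (c : ℝ) :
    constVec 𝓧 (Pi.single i c) = Pi.single i ((𝓧 i).const c) := by
  ext1 j
  rcases eq_or_ne j i with rfl | h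
  · simp [constVec]
  · simp only [constVec, Pi.single_eq_of_ne h]
    rfl

theorem constVec_mono [IsFiniteMeasure P] (𝓧 : Fin d → AdmissibleSpace P) :
    Monotone (constVec 𝓧) := by
  intro m n h i
  rw [(𝓧 i).le_iff]
  filter_upwards [AEEqFun.coeFn_const (μ := P) Ω (m i), AEEqFun.coeFn_const (μ := P) Ω (n i)]
    with ω h1 h2
  have h1' : ((constVec 𝓧 m i : (𝓧 i).space) : Ω →ₘ[P] ℝ) ω = m i := h1
  have h2' : ((constVec 𝓧 n i : (𝓧 i).space) : Ω →ₘ[P] ℝ) ω = n i := h2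
  rw [h1', h2']
  exact h i

theorem vecDual_eq_zero_of_pairing [IsFiniteMeasure P] (𝓧 : Fin d → AdmissibleSpace P)
    {Z : VecDual 𝓧} (h : ∀ V : Vec 𝓧, 0 ≤ V → 0 ≤ vecPairing 𝓧 V Z)
    (h1 : ∀ m, vecPairing 𝓧 (constVec 𝓧 m) Z = 0) : Z = 0 := by
  ext1 i
  refine (𝓧 i).dual_eq_zero_of_pairing (fun V hV => ?_) ?_
  · rw [← vecPairing_single]
    exact h _ (by simpa using hV)
  · rw [← vecPairing_single, ← constVec_single]
    exact h1 _

/-- Makes the weak topology Hausdorff and lets weak convergence be tested one functional at a time.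
-/
theorem vecPairing_injective [IsFiniteMeasure P] (𝓧 : Fin d → AdmissibleSpace P) :
    Function.Injective (vecPairing 𝓧) := by
  refine (injective_iff_map_eq_zero _).2 fun X hX => ?_
  ext1 i
  refine (𝓧 i).eq_zero_of_pairing fun Z => ?_
  have h := LinearMap.congr_fun hX (Pi.single i Z)
  rw [vecPairing_apply, Finset.sum_eq_single i] at h
  · simpa using h
  · intro j _ hj
    simp [Pi.single_eq_of_ne hj]
  · simp

theorem constVec_injective [IsProbabilityMeasure P] (𝓧 : Fin d → AdmissibleSpace P) :
    Function.Injective (constVec 𝓧) := by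
  intro m n h
  ext i
  have hi : AEEqFun.const (μ := P) Ω (m i) = AEEqFun.const Ω (n i) :=
    congrArg Subtype.val (congrFun h i)
  have : ∀ᵐ _ω ∂P, m i = n i := by
    filter_upwards [AEEqFun.coeFn_const (μ := P) Ω (m i),
      AEEqFun.coeFn_const (μ := P) Ω (n i)] with ω h1 h2
    rw [hi, h2] at h1
    exact h1.symm
  simpa using this

/-- If each `𝓧ᵢ'` is the norm dual of `𝓧ᵢ`, every norm-continuous functional on `𝓧` is given by an
element of `𝓧'`. -/
theorem exists_vecPairing_eq {𝓧 : Fin d → AdmissibleSpace P} (hdual : ∀ i, (𝓧 i).DualIsNormDual)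
    (φ : Vec 𝓧 →L[ℝ] ℝ) : ∃ Z : VecDual 𝓧, ∀ X, φ X = vecPairing 𝓧 X Z := by
  have hφ : ∀ i, Continuous (φ.toLinearMap ∘ₗ LinearMap.single ℝ (fun i => (𝓧 i).space) i) :=
    fun i => φ.continuous.comp (continuous_single (A := fun i => (𝓧 i).space) i)
  choose Z hZ using fun i => (hdual i _).1 (hφ i)
  refine ⟨Z, fun X => ?_⟩
  rw [vecPairing_apply]
  simp_rw [← hZ]
  conv_lhs => rw [← Finset.univ_sum_single X]
  simp

/-- If each `𝓧ᵢ'` is the norm dual of `𝓧ᵢ`, norm-closed convex sets are weakly closed. -/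
theorem isClosed_weak_of_isClosed {𝓧 : Fin d → AdmissibleSpace P}
    (hdual : ∀ i, (𝓧 i).DualIsNormDual) {C : Set (Vec 𝓧)} (hconv : Convex ℝ C)
    (hcl : IsClosed C) : IsClosed (X := WeakVec 𝓧) C := by
  refine (isOpen_compl_iff (X := WeakVec 𝓧)).1 ((isOpen_iff_mem_nhds (X := WeakVec 𝓧)).2 ?_)
  intro x hx
  obtain ⟨φ, u, h1, h2⟩ := geometric_hahn_banach_point_closed hconv hcl hx
  obtain ⟨Z, hZ⟩ := exists_vecPairing_eq hdual φ
  have ho : IsOpen (X := WeakVec 𝓧) {X | vecPairing 𝓧 X Z < u} :=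
    isOpen_lt (WeakBilin.eval_continuous (vecPairing 𝓧) Z) continuous_const
  refine Filter.mem_of_superset (ho.mem_nhds ((hZ x).symm.trans_lt h1)) ?_
  intro y hy hyC
  exact lt_asymm (h2 y hyC) ((hZ y).trans_lt hy)

end SystemicRisk

end
-- The acceptable positions `S ⁻¹' 𝓐`.
noncomputable section

namespace SystemicRisk

variable {Ω : Type*} [MeasurableSpace Ω] {P : Measure Ω} {d : ℕ}

section Preimage

variable {𝓧 : Fin d → AdmissibleSpace P} {𝓔 : AdmissibleSpace P} {S : Vec 𝓧 → 𝓔.space}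
  {𝓐 : Set 𝓔.space}

theorem IsAdmissibleAcceptance.mem_of_le (hA : IsAdmissibleAcceptance 𝓧 𝓔 S 𝓐) {U V : 𝓔.space}
    (hU : U ∈ 𝓐) (h : U ≤ V) : V ∈ 𝓐 := by
  have := hA.mono U hU (V - U) (sub_nonneg.2 h)
  rwa [add_sub_cancel] at this

theorem isUpperSet_preimage (hS : IsAdmissibleImpact 𝓧 𝓔 S)
    (hA : IsAdmissibleAcceptance 𝓧 𝓔 S 𝓐) : IsUpperSet (S ⁻¹' 𝓐) :=
  fun _ _ h hX => hA.mem_of_le hX (hS.mono _ _ h)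

theorem convex_preimage (hS : IsAdmissibleImpact 𝓧 𝓔 S)
    (hA : IsAdmissibleAcceptance 𝓧 𝓔 S 𝓐) : Convex ℝ (S ⁻¹' 𝓐) := by
  intro X hX Y hY a b ha hb hab
  obtain rfl : b = 1 - a := by linarith
  exact hA.mem_of_le (hA.convex hX hY ha hb hab) (hS.concave X Y a ha (by linarith))

/-- A functional separating `S X` from `𝓐` is nonnegative, since `𝓐` absorbs the positive cone.
Upper semicontinuity of `S` against that functional then keeps a neighbourhood of `X` out of the
preimage. -/
theorem isClosed_preimage [IsFiniteMeasure P] (hS : IsAdmissibleImpact 𝓧 𝓔 S)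
    (hA : IsAdmissibleAcceptance 𝓧 𝓔 S 𝓐) : IsClosed (X := WeakVec 𝓧) (S ⁻¹' 𝓐) := by
  refine (isOpen_compl_iff (X := WeakVec 𝓧)).1 ((isOpen_iff_mem_nhds (X := WeakVec 𝓧)).2 ?_)
  intro X hX
  obtain ⟨W, u, h1, h2⟩ := exists_separating_of_notMem 𝓔.pairing hA.convex hA.closed hX
  have hW : 0 ≤ W := by
    refine 𝓔.dual_nonneg_of_pairing fun V hV => nonneg_of_forall_le_add_mul (a := 0) (c := u) ?_
    intro t ht
    have := h2 _ (hA.mono 0 hA.zero_mem _ (𝓔.smul_nonneg ht hV))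
    simpa using this.le
  filter_upwards [hS.usc W hW X u h1] with Y hY hYA
  exact lt_asymm hY (h2 _ hYA)

end Preimage

theorem tendsto_weak_iff [IsFiniteMeasure P] (𝓧 : Fin d → AdmissibleSpace P) {ι : Type*}
    {l : Filter ι} {f : ι → Vec 𝓧} {X : Vec 𝓧} :
    Tendsto f l (@nhds (WeakVec 𝓧) _ X) ↔
      ∀ Z, Tendsto (fun i => vecPairing 𝓧 (f i) Z) l (𝓝 (vecPairing 𝓧 X Z)) :=
  WeakBilin.tendsto_iff_forall_eval_tendsto _ (vecPairing_injective 𝓧)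

theorem tendsto_pairing_constVec [IsFiniteMeasure P] (𝓧 : Fin d → AdmissibleSpace P)
    (Z : VecDual 𝓧) {ι : Type*} {l : Filter ι} {k : ι → Fin d → ℝ} {v : Fin d → ℝ}
    (h : Tendsto k l (𝓝 v)) :
    Tendsto (fun i => vecPairing 𝓧 (constVec 𝓧 (k i)) Z) l
      (𝓝 (vecPairing 𝓧 (constVec 𝓧 v) Z)) :=
  (((vecPairing 𝓧).flip Z ∘ₗ constVecLin 𝓧).continuous_of_finiteDimensional.tendsto v).comp h

/-! ### Capital requirements of convex upper sets. -/

variable [IsProbabilityMeasure P] {𝓧 : Fin d → AdmissibleSpace P} {C : Set (Vec 𝓧)}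

/-- The capital requirement `inf {∑ i, m_i ; X + m ∈ C}` associated with a set `C`. -/
def capital (C : Set (Vec 𝓧)) (X : Vec 𝓧) : EReal :=
  sInf {r : EReal | ∃ m : Fin d → ℝ, X + constVec 𝓧 m ∈ C ∧ r = ((∑ i, m i : ℝ) : EReal)}

theorem capital_le {X : Vec 𝓧} {m : Fin d → ℝ} (h : X + constVec 𝓧 m ∈ C) :
    capital C X ≤ ((∑ i, m i : ℝ) : EReal) :=
  sInf_le ⟨m, h, rfl⟩

theorem exists_of_capital_lt {X : Vec 𝓧} {r : EReal} (h : capital C X < r) :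
    ∃ m : Fin d → ℝ, X + constVec 𝓧 m ∈ C ∧ ((∑ i, m i : ℝ) : EReal) < r := by
  obtain ⟨_, ⟨m, hm, rfl⟩, hlt⟩ := sInf_lt_iff.1 h
  exact ⟨m, hm, hlt⟩

theorem constVec_add (m n : Fin d → ℝ) : constVec 𝓧 (m + n) = constVec 𝓧 m + constVec 𝓧 n := rfl

theorem constVec_smul (c : ℝ) (m : Fin d → ℝ) : constVec 𝓧 (c • m) = c • constVec 𝓧 m := rfl

theorem constVec_zero : constVec 𝓧 0 = 0 := (constVecLin 𝓧).map_zero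

theorem constVec_nonneg {m : Fin d → ℝ} (hm : 0 ≤ m) : 0 ≤ constVec 𝓧 m := by
  rw [← constVec_zero]
  exact constVec_mono 𝓧 hm

/-- The slack `r - ∑ m` is added to coordinate `i₀`; an upper set tolerates this. -/
theorem exists_sum_eq_of_capital_lt (hup : IsUpperSet C) (i₀ : Fin d) {X : Vec 𝓧} {r : ℝ}
    (h : capital C X < r) : ∃ m : Fin d → ℝ, X + constVec 𝓧 m ∈ C ∧ ∑ i, m i = r := by
  obtain ⟨m, hm, hlt⟩ := exists_of_capital_lt h
  have hlt' : ∑ i, m i < r := EReal.coe_lt_coe_iff.1 hlt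
  refine ⟨m + Pi.single i₀ (r - ∑ i, m i), hup ?_ hm, ?_⟩
  · gcongr
    rw [constVec_add]
    exact le_add_of_nonneg_right (constVec_nonneg (by simpa using hlt'.le))
  · simp [Finset.sum_add_distrib]

theorem capital_antitone (hup : IsUpperSet C) : Antitone (capital C) := by
  intro X Y h
  refine le_sInf ?_
  rintro _ ⟨m, hm, rfl⟩
  exact capital_le (hup (by gcongr) hm)

theorem mem_combination (hconv : Convex ℝ C) {X Y : Vec 𝓧} {m n : Fin d → ℝ} {a b : ℝ}
    (ha : 0 ≤ a) (hb : 0 ≤ b) (hab : a + b = 1) (hX : X + constVec 𝓧 m ∈ C)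
    (hY : Y + constVec 𝓧 n ∈ C) : a • X + b • Y + constVec 𝓧 (a • m + b • n) ∈ C := by
  have h := hconv hX hY ha hb hab
  rw [constVec_add, constVec_smul, constVec_smul]
  convert h using 1
  module

theorem capital_combination_le (hconv : Convex ℝ C) {X Y : Vec 𝓧} {r s a b : ℝ} (ha : 0 ≤ a)
    (hb : 0 ≤ b) (hab : a + b = 1) (hX : capital C X < r) (hY : capital C Y < s) :
    capital C (a • X + b • Y) ≤ ((a * r + b * s : ℝ) : EReal) := by
  obtain ⟨m, hm, hmr⟩ := exists_of_capital_lt hX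
  obtain ⟨n, hn, hns⟩ := exists_of_capital_lt hY
  refine (capital_le (mem_combination hconv ha hb hab hm hn)).trans (EReal.coe_le_coe_iff.2 ?_)
  have h1 := EReal.coe_lt_coe_iff.1 hmr
  have h2 := EReal.coe_lt_coe_iff.1 hns
  simp only [Pi.add_apply, Pi.smul_apply, smul_eq_mul, Finset.sum_add_distrib, ← Finset.mul_sum]
  gcongr

theorem finiteValued_capital (hconv : Convex ℝ C) (htop : ∀ X, capital C X ≠ ⊤)
    (h0 : capital C 0 ≠ ⊥) : FiniteValued (capital C) := by
  refine fun X => ⟨fun hX => h0 ?_, htop X⟩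
  obtain ⟨s, hs, -⟩ := EReal.lt_iff_exists_real_btwn.1 (lt_top_iff_ne_top.2 (htop (-X)))
  refine (EReal.eq_bot_iff_forall_lt _).2 fun y => ?_
  -- `0` is the midpoint of `X` and `-X`, and the average of `2 * y - s - 2` and `s` is `y - 1 < y`.
  have hXr : capital C X < ((2 * y - s - 2 : ℝ) : EReal) := by
    rw [hX]; exact EReal.bot_lt_coe _
  have h := capital_combination_le hconv (a := 1 / 2) (b := 1 / 2) (by norm_num) (by norm_num)
    (by norm_num) hXr hs
  rw [smul_neg, add_neg_cancel] at h
  exact h.trans_lt (EReal.coe_lt_coe_iff.2 (by linarith))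

theorem coe_toReal_capital (hfin : FiniteValued (capital C)) (X : Vec 𝓧) :
    ((capital C X).toReal : EReal) = capital C X :=
  EReal.coe_toReal (hfin X).2 (hfin X).1

theorem convexOn_toReal_capital (hconv : Convex ℝ C) (hfin : FiniteValued (capital C)) :
    ConvexOn ℝ Set.univ fun X => (capital C X).toReal := by
  refine ⟨convex_univ, fun X _ Y _ a b ha hb hab => le_of_forall_pos_le_add fun ε hε => ?_⟩
  have hlt : ∀ X, capital C X < (((capital C X).toReal + ε : ℝ) : EReal) := by
    intro X
    conv_lhs => rw [← coe_toReal_capital hfin X]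
    exact EReal.coe_lt_coe_iff.2 (by linarith)
  have h := capital_combination_le hconv ha hb hab (hlt X) (hlt Y)
  rw [← coe_toReal_capital hfin] at h
  have h' := EReal.coe_le_coe_iff.1 h
  simp only [smul_eq_mul]
  calc _ ≤ _ := h'
    _ = a * (capital C X).toReal + b * (capital C Y).toReal + (a + b) * ε := by ring
    _ = _ := by rw [hab, one_mul]

/-- A proper upper set which is weakly closed and convex cannot contain all constants. -/
theorem exists_constVec_notMem (hconv : Convex ℝ C) (hcl : IsClosed (X := WeakVec 𝓧) C)
    (hup : IsUpperSet C) (hne : C ≠ Set.univ) : ∃ m, constVec 𝓧 m ∉ C := by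
  by_contra! hall
  obtain ⟨X, hX⟩ := (Set.ne_univ_iff_exists_notMem C).1 hne
  obtain ⟨Z, u, h1, h2⟩ := exists_separating_of_notMem (vecPairing 𝓧) hconv hcl hX
  have h0 : (0 : Vec 𝓧) ∈ C := by
    rw [← constVec_zero]; exact hall 0
  -- A functional bounded below on the subspace of constants vanishes on it; being also positive, it
  -- is zero.
  have hray : ∀ m, 0 ≤ vecPairing 𝓧 (constVec 𝓧 m) Z := by
    refine fun m => nonneg_of_forall_le_add_mul (a := 0) (c := u) fun t _ => ?_
    have := h2 _ (hall (t • m))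
    rw [constVec_smul] at this
    simpa using this.le
  have hZ : Z = 0 := by
    refine vecDual_eq_zero_of_pairing 𝓧 (fun V hV => ?_) fun m => le_antisymm ?_ (hray m)
    · refine nonneg_of_forall_le_add_mul (a := 0) (c := u) fun t ht => ?_
      have := h2 _ (hup (show (0 : Vec 𝓧) ≤ t • V from
        fun i => (𝓧 i).smul_nonneg ht (hV i)) h0)
      simpa using this.le
    · have := hray (-m)
      rw [show constVec 𝓧 (-m) = -constVec 𝓧 m from (constVecLin 𝓧).map_neg m] at this
      simpa using this
  subst hZ
  have := h2 0 h0
  rw [map_zero] at h1 this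
  exact lt_asymm h1 this

end SystemicRisk

end
-- Recession argument for `C ∩ 𝓜₀ = {0}`.
noncomputable section

namespace SystemicRisk

variable {Ω : Type*} [MeasurableSpace Ω] {P : Measure Ω} {d : ℕ}
variable [IsProbabilityMeasure P] {𝓧 : Fin d → AdmissibleSpace P} {C : Set (Vec 𝓧)}

/-- If `C ∩ 𝓜₀ = {0}`, then `X_i + k_i ∈ C` with `X_i` weakly convergent and `k_i ∈ 𝓜₀` is
impossible along a filter on which `k_i` is unbounded. -/
theorem not_tendsto_norm_atTop (hconv : Convex ℝ C) (hcl : IsClosed (X := WeakVec 𝓧) C)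
    (h0 : (0 : Vec 𝓧) ∈ C) (hM : C ∩ M0 𝓧 = {0}) {ι : Type*} {l : Filter ι} [l.NeBot]
    {x : ι → Vec 𝓧} {k : ι → Fin d → ℝ} {X : Vec 𝓧}
    (hx : Tendsto x l (@nhds (WeakVec 𝓧) _ X)) (hk : ∀ᶠ i in l, ∑ j, k i j = 0)
    (hC : ∀ᶠ i in l, x i + constVec 𝓧 (k i) ∈ C) : ¬ Tendsto (fun i => ‖k i‖) l atTop := by
  intro hnorm
  let U := Ultrafilter.of l
  have hU : (U : Filter ι) ≤ l := Ultrafilter.of_le l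
  -- Directions of `k i` converge along the ultrafilter by compactness of the sphere, while the
  -- scaling kills the contribution of `x i`.
  let u : ι → Fin d → ℝ := fun i => ‖k i‖⁻¹ • k i
  have hge : ∀ᶠ i in U, 1 ≤ ‖k i‖ := hU (hnorm.eventually_ge_atTop 1)
  have hsph : ∀ᶠ i in U, u i ∈ Metric.sphere (0 : Fin d → ℝ) 1 := by
    filter_upwards [hge] with i hi
    have : ‖k i‖ ≠ 0 := by linarith
    simp [u, norm_smul, this]
  obtain ⟨v, hv, hvU⟩ := (isCompact_sphere (0 : Fin d → ℝ) 1).ultrafilter_le_nhds' (U.map u) hsph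
  have hu : Tendsto u U (𝓝 v) := hvU
  have hinv : Tendsto (fun i => ‖k i‖⁻¹) U (𝓝 0) := tendsto_inv_atTop_zero.comp (hnorm.mono_left hU)
  have hsum : ∑ j, v j = 0 := by
    have h1 : Tendsto (fun i => ∑ j, u i j) U (𝓝 (∑ j, v j)) :=
      tendsto_finsetSum _ fun j _ => (tendsto_pi_nhds.1 hu) j
    refine tendsto_nhds_unique h1 (tendsto_const_nhds.congr' ?_)
    filter_upwards [hU hk] with i hi
    simp [u, ← Finset.mul_sum, hi]
  have hlim : Tendsto (fun i => ‖k i‖⁻¹ • (x i + constVec 𝓧 (k i))) U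
      (@nhds (WeakVec 𝓧) _ (constVec 𝓧 v)) := by
    rw [tendsto_weak_iff]
    intro Z
    have h1 := (hinv.mul (((tendsto_weak_iff 𝓧).1 hx Z).mono_left hU)).add
      (tendsto_pairing_constVec 𝓧 Z hu)
    rw [zero_mul, zero_add] at h1
    refine h1.congr fun i => ?_
    simp [u, constVec_smul]
  have hmem : constVec 𝓧 v ∈ C := by
    refine hcl.mem_of_tendsto hlim ?_
    filter_upwards [hge, hU hC] with i hi hCi
    exact hconv.smul_mem_of_zero_mem h0 hCi ⟨by positivity, inv_le_one_of_one_le₀ hi⟩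
  have hz : constVec 𝓧 v ∈ C ∩ M0 𝓧 := ⟨hmem, v, hsum, rfl⟩
  rw [hM] at hz
  have hv0 : v = 0 := constVec_injective 𝓧 (hz.trans constVec_zero.symm)
  simp [hv0] at hv

theorem lowerSemicontinuous_capital (hconv : Convex ℝ C) (hcl : IsClosed (X := WeakVec 𝓧) C)
    (hup : IsUpperSet C) (h0 : (0 : Vec 𝓧) ∈ C) (hM : C ∩ M0 𝓧 = {0}) (i₀ : Fin d) :
    LowerSemicontinuous (α := WeakVec 𝓧) (capital C) := by
  intro (X : Vec 𝓧) y hy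
  by_contra hcon
  obtain ⟨r, hyr, hrX⟩ := EReal.lt_iff_exists_real_btwn.1 hy
  have hfr : ∃ᶠ x in @nhds (WeakVec 𝓧) _ X, ¬ y < capital C x := not_eventually.1 hcon
  obtain ⟨F, hF⟩ : ∃ F : Filter (Vec 𝓧),
      F = @nhds (WeakVec 𝓧) _ X ⊓ 𝓟 {x | ¬ y < capital C x} := ⟨_, rfl⟩
  have hne : F.NeBot := hF ▸ frequently_iff_neBot.1 hfr
  -- The weak topology need not be first countable, so an ultrafilter replaces a sequence.
  let U : Ultrafilter (Vec 𝓧) := Ultrafilter.of F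
  have hU : (U : Filter (Vec 𝓧)) ≤ @nhds (WeakVec 𝓧) _ X ⊓ 𝓟 {x | ¬ y < capital C x} :=
    hF ▸ Ultrafilter.of_le F
  have hlt : ∀ᶠ x in (U : Filter (Vec 𝓧)), capital C x < r := by
    have : ∀ᶠ x in (U : Filter (Vec 𝓧)), ¬ y < capital C x :=
      (hU.trans inf_le_right) (mem_principal_self _)
    filter_upwards [this] with x hx
    exact (not_lt.1 hx).trans_lt hyr
  have hid : Tendsto (fun x : Vec 𝓧 => x) U (@nhds (WeakVec 𝓧) _ X) := hU.trans inf_le_left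
  -- Fixing the total at exactly `r` splits each allocation into a fixed vector and a part in `𝓜₀`.
  have hex : ∀ x : Vec 𝓧, capital C x < r → ∃ k : Fin d → ℝ, ∑ j, k j = 0 ∧
      x + constVec 𝓧 (Pi.single i₀ r) + constVec 𝓧 k ∈ C := by
    intro x hx
    obtain ⟨m, hm, hs⟩ := exists_sum_eq_of_capital_lt hup i₀ hx
    refine ⟨m - Pi.single i₀ r, by simp [hs], ?_⟩
    rwa [add_assoc, ← constVec_add, add_sub_cancel]
  choose! k hk0 hkC using hex
  have hx : Tendsto (fun x : Vec 𝓧 => x + constVec 𝓧 (Pi.single i₀ r)) U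
      (@nhds (WeakVec 𝓧) _ (X + constVec 𝓧 (Pi.single i₀ r))) := by
    rw [tendsto_weak_iff] at hid ⊢
    intro Z
    simpa using (hid Z).add_const (vecPairing 𝓧 (constVec 𝓧 (Pi.single i₀ r)) Z)
  have hunb := not_tendsto_norm_atTop hconv hcl h0 hM hx
    (hlt.mono fun x hx => hk0 x hx) (hlt.mono fun x hx => hkC x hx)
  rw [tendsto_atTop] at hunb
  push Not at hunb
  obtain ⟨R, hR⟩ := hunb
  -- Along an ultrafilter, not being eventually at least `R` means being eventually below `R`.
  have hball : ∀ᶠ x in (U : Filter (Vec 𝓧)), k x ∈ Metric.closedBall (0 : Fin d → ℝ) R := by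
    filter_upwards [hR] with x hx
    simpa using hx.le
  obtain ⟨v, -, hvU⟩ :=
    (isCompact_closedBall (0 : Fin d → ℝ) R).ultrafilter_le_nhds' (U.map k) hball
  have hv : Tendsto k U (𝓝 v) := hvU
  have hsum : ∑ j, v j = 0 := by
    have h1 : Tendsto (fun i => ∑ j, k i j) U (𝓝 (∑ j, v j)) :=
      tendsto_finsetSum _ fun j _ => (tendsto_pi_nhds.1 hv) j
    refine tendsto_nhds_unique h1 (tendsto_const_nhds.congr' ?_)
    filter_upwards [hlt] with x hx
    exact (hk0 x hx).symm
  have hmem : X + constVec 𝓧 (Pi.single i₀ r) + constVec 𝓧 v ∈ C := by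
    have hlim : Tendsto (fun x : Vec 𝓧 => x + constVec 𝓧 (Pi.single i₀ r) + constVec 𝓧 (k x)) U
        (@nhds (WeakVec 𝓧) _ (X + constVec 𝓧 (Pi.single i₀ r) + constVec 𝓧 v)) := by
      rw [tendsto_weak_iff] at hx ⊢
      intro Z
      simpa using (hx Z).add (tendsto_pairing_constVec 𝓧 Z hv)
    exact hcl.mem_of_tendsto hlim (hlt.mono fun x hx => hkC x hx)
  rw [add_assoc, ← constVec_add] at hmem
  have hle := capital_le hmem
  have hs : ∑ i, (Pi.single i₀ r + v : Fin d → ℝ) i = r := by simp [Finset.sum_add_distrib, hsum]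
  rw [hs] at hle
  exact absurd hle (not_le.2 hrX)

theorem capital_ne_bot (hconv : Convex ℝ C) (hcl : IsClosed (X := WeakVec 𝓧) C)
    (hup : IsUpperSet C) (h0 : (0 : Vec 𝓧) ∈ C) (hne : C ≠ Set.univ) (hM : C ∩ M0 𝓧 = {0})
    (i₀ : Fin d) (X : Vec 𝓧) : capital C X ≠ ⊥ := by
  intro hX
  have hex : ∀ r : ℝ, ∃ m : Fin d → ℝ, X + constVec 𝓧 m ∈ C ∧ ∑ i, m i = r := fun r =>
    exists_sum_eq_of_capital_lt hup i₀ (by rw [hX]; exact EReal.bot_lt_coe r)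
  by_cases hsub : Subsingleton (Fin d)
  -- With one coordinate `𝓜₀` is trivial. Here the total determines the allocation, so `X` plus
  -- every constant lies in `C`; scaling by `1 / n` puts every constant in `C`.
  · obtain ⟨m, hm⟩ := exists_constVec_notMem hconv hcl hup hne
    refine hm ?_
    have hmem : ∀ n : ℕ, X + constVec 𝓧 ((n : ℝ) • m) ∈ C := by
      intro n
      obtain ⟨m', hm', hs⟩ := hex (∑ i, ((n : ℝ) • m) i)
      have heq : m' = (n : ℝ) • m := by
        ext i
        rwa [Fintype.sum_subsingleton _ i, Fintype.sum_subsingleton _ i] at hs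
      rwa [heq] at hm'
    have hinv : Tendsto (fun n : ℕ => (n : ℝ)⁻¹) atTop (𝓝 0) := tendsto_inv_atTop_nhds_zero_nat
    have hlim : Tendsto (fun n : ℕ => (n : ℝ)⁻¹ • (X + constVec 𝓧 ((n : ℝ) • m))) atTop
        (@nhds (WeakVec 𝓧) _ (constVec 𝓧 m)) := by
      rw [tendsto_weak_iff]
      intro Z
      have h1 := (hinv.mul_const (vecPairing 𝓧 X Z)).add_const (vecPairing 𝓧 (constVec 𝓧 m) Z)
      rw [zero_mul, zero_add] at h1
      refine h1.congr' ?_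
      filter_upwards [eventually_ge_atTop 1] with n hn
      have hn' : (n : ℝ) ≠ 0 := by positivity
      simp [constVec_smul, hn']
    refine hcl.mem_of_tendsto hlim ?_
    filter_upwards [eventually_ge_atTop 1] with n hn
    exact hconv.smul_mem_of_zero_mem h0 (hmem n)
      ⟨by positivity, inv_le_one_of_one_le₀ (by exact_mod_cast hn)⟩
  · rw [not_subsingleton_iff_nontrivial] at hsub
    obtain ⟨i, j, hij⟩ := hsub
    have hk : ∀ n : ℕ, ∃ k : Fin d → ℝ, ∑ i, k i = 0 ∧ X + constVec 𝓧 k ∈ C ∧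
        (n : ℝ) / 2 ≤ ‖k‖ := by
      intro n
      obtain ⟨m, hm, hs⟩ := hex (-n)
      have hmem : ∀ i, X + constVec 𝓧 (m + Pi.single i (n : ℝ)) ∈ C := by
        refine fun i => hup ?_ hm
        gcongr
        rw [constVec_add]
        exact le_add_of_nonneg_right (constVec_nonneg (by simp))
      have hsum : ∀ i, ∑ l, (m + Pi.single i (n : ℝ) : Fin d → ℝ) l = 0 := by
        intro i
        simp [Finset.sum_add_distrib, hs]
      -- The two candidates, shifted along `i` and along `j`, differ by `n` in coordinate `i`, so
      -- one of them has norm at least `n / 2`.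
      by_cases hle : (n : ℝ) / 2 ≤ ‖m + Pi.single i (n : ℝ)‖
      · exact ⟨_, hsum i, hmem i, hle⟩
      · refine ⟨_, hsum j, hmem j, ?_⟩
        have h1 := norm_sub_le (m + Pi.single i (n : ℝ)) (m + Pi.single j (n : ℝ))
        have h2 := norm_le_pi_norm (m + Pi.single i (n : ℝ) - (m + Pi.single j (n : ℝ))) i
        simp [Pi.single_eq_of_ne hij] at h2
        rw [add_sub_add_left_eq_sub] at h1
        linarith
    choose k hk0 hkC hkn using hk
    refine not_tendsto_norm_atTop hconv hcl h0 hM (l := atTop) (x := fun _ : ℕ => X) (k := k)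
      (tendsto_const_nhds (X := WeakVec 𝓧)) (.of_forall hk0) (.of_forall hkC) ?_
    exact tendsto_atTop_mono hkn (tendsto_natCast_atTop_atTop.atTop_div_const (by norm_num))

/-! ### Finite-valued capital requirements. -/

/-- A finite-valued capital requirement of a convex upper set is norm continuous. -/
theorem continuous_toReal_capital (hconv : Convex ℝ C) (hup : IsUpperSet C)
    (hfin : FiniteValued (capital C)) : Continuous fun X => (capital C X).toReal := by
  have hanti : Antitone fun X => (capital C X).toReal := fun X Y h =>
    EReal.toReal_le_toReal (capital_antitone hup h) (hfin Y).1 (hfin X).2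
  rw [← continuousOn_univ]
  -- For a convex function on an open set, continuity amounts to boundedness above near one point.
  have h := (ConvexOn.continuousOn_tfae isOpen_univ Set.univ_nonempty
    (convexOn_toReal_capital hconv hfin)).out 1 3
  refine h.2 ⟨0, Set.mem_univ _, ?_⟩
  exact hanti.isBoundedUnder_nhds_zero (isClosed_nonneg_vec 𝓧) (exists_abs_vec 𝓧)

theorem lowerSemicontinuous_capital_of_finiteValued (hdual : ∀ i, (𝓧 i).DualIsNormDual)
    (hconv : Convex ℝ C) (hup : IsUpperSet C) (hfin : FiniteValued (capital C)) :
    LowerSemicontinuous (α := WeakVec 𝓧) (capital C) := by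
  intro X y hy
  obtain ⟨r, hyr, hrX⟩ := EReal.lt_iff_exists_real_btwn.1 hy
  have hcl : IsClosed (X := WeakVec 𝓧) {X : Vec 𝓧 | (capital C X).toReal ≤ r} := by
    refine isClosed_weak_of_isClosed hdual ?_
      (isClosed_le (continuous_toReal_capital hconv hup hfin) continuous_const)
    have h := (convexOn_toReal_capital hconv hfin).convex_le r
    simp only [Set.mem_univ, true_and] at h
    exact h
  have hX : X ∉ {X : Vec 𝓧 | (capital C X).toReal ≤ r} := by
    intro h
    refine absurd hrX (not_lt.2 ?_)
    exact (coe_toReal_capital hfin X).symm.le.trans (EReal.coe_le_coe_iff.2 h)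
  filter_upwards [hcl.isOpen_compl.mem_nhds hX] with Y hY
  exact hyr.trans ((EReal.coe_lt_coe_iff.2 (not_le.1 hY)).trans_eq (coe_toReal_capital hfin Y))

theorem capital_ne_top_of_interior (hdual : ∀ i, (𝓧 i).DualIsNormDual)
    (hconv : Convex ℝ C) (hup : IsUpperSet C) (hint : (interior C).Nonempty) (Y : Vec 𝓧) :
    capital C Y ≠ ⊤ := by
  intro hY
  have hdisj : Disjoint (interior C) (Set.range fun m => Y + constVec 𝓧 m) := by
    rw [Set.disjoint_left]
    rintro _ hm ⟨m, rfl⟩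
    have := capital_le (interior_subset hm)
    rw [hY, top_le_iff] at this
    exact EReal.coe_ne_top _ this
  have hrange : Convex ℝ (Set.range fun m => Y + constVec 𝓧 m) := by
    rintro _ ⟨m, rfl⟩ _ ⟨n, rfl⟩ a b ha hb hab
    refine ⟨a • m + b • n, ?_⟩
    obtain rfl : b = 1 - a := by linarith
    simp only [constVec_add, constVec_smul]
    module
  obtain ⟨φ, u, h1, h2⟩ := geometric_hahn_banach_open hconv.interior isOpen_interior hrange hdisj
  -- The sign is flipped because `φ` is bounded above on the upper set `interior C`, so `-φ` is the
  -- positive functional.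
  obtain ⟨Z, hZ⟩ := exists_vecPairing_eq hdual (-φ)
  obtain ⟨X₀, hX₀⟩ := hint
  have hconst : ∀ m, vecPairing 𝓧 (constVec 𝓧 m) Z ≤ 0 := by
    intro m
    rw [← neg_nonneg, ← hZ]
    refine nonneg_of_forall_le_add_mul (a := φ Y) (c := u) fun t _ => ?_
    have := h2 _ ⟨t • m, rfl⟩
    simpa [constVec_smul] using this
  have hZ0 : Z = 0 := by
    refine vecDual_eq_zero_of_pairing 𝓧 (fun V hV => ?_) fun m => le_antisymm (hconst m) ?_
    · refine nonneg_of_forall_le_add_mul (a := -φ X₀) (c := -u) fun t ht => ?_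
      have hmem : X₀ + t • V ∈ interior C :=
        hup.interior (le_add_of_nonneg_right fun i => (𝓧 i).smul_nonneg ht (hV i)) hX₀
      have := h1 _ hmem
      rw [← hZ]
      simp at this ⊢
      linarith
    · have := hconst (-m)
      rw [show constVec 𝓧 (-m) = -constVec 𝓧 m from (constVecLin 𝓧).map_neg m] at this
      simpa using this
  have hφ : ∀ X, φ X = 0 := by
    intro X
    have := hZ X
    rw [hZ0, map_zero] at this
    simpa using this
  have ha := h1 _ hX₀
  have hb := h2 _ ⟨0, rfl⟩
  rw [hφ] at ha hb
  linarith

section Finite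

variable [Finite Ω]

instance finiteDimensional_aeEqFun : FiniteDimensional ℝ (Ω →ₘ[P] ℝ) := by
  let W : Submodule ℝ (Ω → ℝ) :=
    { carrier := {f | AEStronglyMeasurable f P}
      zero_mem' := aestronglyMeasurable_zero
      add_mem' := fun hf hg => hf.add hg
      smul_mem' := fun c _ hf => hf.const_smul c }
  let φ : W →ₗ[ℝ] (Ω →ₘ[P] ℝ) :=
    { toFun := fun f => AEEqFun.mk f.1 f.2
      map_add' := fun _ _ => rfl
      map_smul' := fun _ _ => rfl }
  refine Module.Finite.of_surjective φ fun X => ?_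
  exact ⟨⟨X, X.aestronglyMeasurable⟩, AEEqFun.mk_coeFn X⟩

theorem exists_nonneg_add_constVec (X : Vec 𝓧) : ∃ m, 0 ≤ X + constVec 𝓧 m := by
  have hb : ∀ i, ∃ c : ℝ, ∀ ω, 0 ≤ (X i : Ω →ₘ[P] ℝ) ω + c := by
    intro i
    obtain ⟨c, hc⟩ := (Set.finite_range (X i : Ω →ₘ[P] ℝ)).bddBelow
    exact ⟨-c, fun ω => by linarith [hc ⟨ω, rfl⟩]⟩
  choose m hm using hb
  refine ⟨m, fun i => ?_⟩
  change 0 ≤ X i + (𝓧 i).const (m i)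
  rw [(𝓧 i).nonneg_iff]
  filter_upwards [AEEqFun.coeFn_const (μ := P) Ω (m i),
    AEEqFun.coeFn_add (X i : Ω →ₘ[P] ℝ) (AEEqFun.const Ω (m i))] with ω h1 h2
  have h2' : ((X i + (𝓧 i).const (m i) : (𝓧 i).space) : Ω →ₘ[P] ℝ) ω = _ := h2
  rw [h2', Pi.add_apply, h1]
  exact hm i ω

theorem capital_ne_top_of_finite (hup : IsUpperSet C) (h0 : (0 : Vec 𝓧) ∈ C) (X : Vec 𝓧) :
    capital C X ≠ ⊤ := by
  obtain ⟨m, hm⟩ := exists_nonneg_add_constVec X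
  exact ((capital_le (hup hm h0)).trans_lt (EReal.coe_lt_top _)).ne

/-- A linear map out of a finite-dimensional Hausdorff topological vector space is continuous. -/
theorem continuous_ofWeak : Continuous (X := WeakVec 𝓧) (Y := Vec 𝓧) fun X => X := by
  have : T2Space (WeakVec 𝓧) := (WeakBilin.isEmbedding (vecPairing_injective 𝓧)).t2Space
  have : FiniteDimensional ℝ (WeakVec 𝓧) := inferInstanceAs (FiniteDimensional ℝ (Vec 𝓧))
  let e : WeakVec 𝓧 →ₗ[ℝ] Vec 𝓧 := (LinearMap.id : Vec 𝓧 →ₗ[ℝ] Vec 𝓧)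
  exact e.continuous_of_finiteDimensional

end Finite

theorem continuous_capital (hconv : Convex ℝ C) (hup : IsUpperSet C)
    (hfin : FiniteValued (capital C)) : Continuous (capital C) := by
  have h := continuous_coe_real_ereal.comp (continuous_toReal_capital hconv hup hfin)
  exact h.congr fun X => coe_toReal_capital hfin X

end SystemicRisk

end
-- Assembly of the five statements.
theorem SystemicRisk.AdmissibleSpace.eq_zero_of_const_eq_zero {Ω : Type*} [MeasurableSpace Ω]
    {P : Measure Ω} [IsProbabilityMeasure P] (L : SystemicRisk.AdmissibleSpace P) {c : ℝ}
    (h : L.const c = 0) : c = 0 := by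
  have hc : AEEqFun.const (μ := P) Ω c = 0 := congrArg Subtype.val h
  have : ∀ᵐ _ω ∂P, c = 0 := by
    filter_upwards [AEEqFun.coeFn_const (μ := P) Ω c,
      AEEqFun.coeFn_zero (μ := P) (α := Ω) (β := ℝ)] with ω h1 h2
    rw [hc, h2] at h1
    exact h1.symm
  simpa using this

theorem mainTheorem6 {Ω : Type*} [MeasurableSpace Ω] (P : Measure Ω) [IsProbabilityMeasure P]
    (d : ℕ) (𝓧 : Fin d → SystemicRisk.AdmissibleSpace P) (𝓔 : SystemicRisk.AdmissibleSpace P)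
    (S : SystemicRisk.Vec 𝓧 → 𝓔.space) (hS : SystemicRisk.IsAdmissibleImpact 𝓧 𝓔 S)
    (𝓐 : Set 𝓔.space) (hA : SystemicRisk.IsAdmissibleAcceptance 𝓧 𝓔 S 𝓐) :
    -- (i): continuity for the product norm topology and for `σ(𝓧, 𝓧')`
    (Finite Ω → SystemicRisk.rho 𝓧 𝓔 S 𝓐 0 ≠ ⊥ →
      SystemicRisk.FiniteValued (SystemicRisk.rho 𝓧 𝓔 S 𝓐) ∧
      Continuous (SystemicRisk.rho 𝓧 𝓔 S 𝓐) ∧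
      Continuous (X := SystemicRisk.WeakVec 𝓧) (SystemicRisk.rho 𝓧 𝓔 S 𝓐)) ∧
    -- (ii)
    ((∀ i, (𝓧 i).DualIsNormDual) →
      SystemicRisk.FiniteValued (SystemicRisk.rho 𝓧 𝓔 S 𝓐) →
      LowerSemicontinuous (α := SystemicRisk.WeakVec 𝓧) (SystemicRisk.rho 𝓧 𝓔 S 𝓐)) ∧
    -- (iii)
    ((∀ i, (𝓧 i).DualIsNormDual) →
      (interior (S ⁻¹' 𝓐)).Nonempty → SystemicRisk.rho 𝓧 𝓔 S 𝓐 0 ≠ ⊥ →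
      SystemicRisk.FiniteValued (SystemicRisk.rho 𝓧 𝓔 S 𝓐) ∧
      LowerSemicontinuous (α := SystemicRisk.WeakVec 𝓧) (SystemicRisk.rho 𝓧 𝓔 S 𝓐)) ∧
    -- (iv)
    (S ⁻¹' 𝓐 ∩ SystemicRisk.M0 𝓧 = {0} →
      SystemicRisk.IsProper (SystemicRisk.rho 𝓧 𝓔 S 𝓐) ∧
      LowerSemicontinuous (α := SystemicRisk.WeakVec 𝓧) (SystemicRisk.rho 𝓧 𝓔 S 𝓐)) ∧
    -- (v)
    (𝓐 ∩ 𝓔.const '' Set.Iic 0 = {0} →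
      (∀ m : Fin d → ℝ, ∑ i, m i = 0 → m ≠ 0 →
        ∃ c : ℝ, c < 0 ∧ S (SystemicRisk.constVec 𝓧 m) = 𝓔.const c) →
      SystemicRisk.IsProper (SystemicRisk.rho 𝓧 𝓔 S 𝓐) ∧
      LowerSemicontinuous (α := SystemicRisk.WeakVec 𝓧) (SystemicRisk.rho 𝓧 𝓔 S 𝓐)) := by
  have hconv := SystemicRisk.convex_preimage hS hA
  have hup := SystemicRisk.isUpperSet_preimage hS hA
  have hcl := SystemicRisk.isClosed_preimage hS hA
  have h0 : (0 : SystemicRisk.Vec 𝓧) ∈ S ⁻¹' 𝓐 := by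
    rw [Set.mem_preimage, hS.map_zero]
    exact hA.zero_mem
  -- For `d = 0` the space `𝓧` is a single point, contradicting that `S` is nonconstant.
  obtain ⟨i₀⟩ : Nonempty (Fin d) := by
    by_contra hd
    have hemp : IsEmpty (Fin d) := not_nonempty_iff.1 hd
    obtain ⟨X, Y, hXY⟩ := hS.not_constant
    exact hXY (congrArg S (Subsingleton.elim X Y))
  have hiv : S ⁻¹' 𝓐 ∩ SystemicRisk.M0 𝓧 = {0} →
      SystemicRisk.IsProper (SystemicRisk.rho 𝓧 𝓔 S 𝓐) ∧
      LowerSemicontinuous (α := SystemicRisk.WeakVec 𝓧) (SystemicRisk.rho 𝓧 𝓔 S 𝓐) := by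
    intro hM
    -- `rho 𝓧 𝓔 S 𝓐` is definitionally `capital (S ⁻¹' 𝓐)`.
    refine ⟨⟨SystemicRisk.capital_ne_bot hconv hcl hup h0 hA.proper hM i₀, 0, ?_⟩,
      SystemicRisk.lowerSemicontinuous_capital hconv hcl hup h0 hM i₀⟩
    have hle := SystemicRisk.capital_le (C := S ⁻¹' 𝓐) (X := 0) (m := 0)
      (by rwa [SystemicRisk.constVec_zero, add_zero])
    exact (hle.trans_lt (EReal.coe_lt_top _)).ne
  refine ⟨fun hfin hbot => ?_, fun hdual hfin => ?_, fun hdual hint hbot => ?_, hiv,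
    fun hA0 hSm => hiv ?_⟩
  · have hfv := SystemicRisk.finiteValued_capital hconv
      (SystemicRisk.capital_ne_top_of_finite hup h0) hbot
    have hc := SystemicRisk.continuous_capital hconv hup hfv
    exact ⟨hfv, hc, hc.comp SystemicRisk.continuous_ofWeak⟩
  · exact SystemicRisk.lowerSemicontinuous_capital_of_finiteValued hdual hconv hup hfin
  · have hfv := SystemicRisk.finiteValued_capital hconv
      (SystemicRisk.capital_ne_top_of_interior hdual hconv hup hint) hbot
    exact ⟨hfv, SystemicRisk.lowerSemicontinuous_capital_of_finiteValued hdual hconv hup hfv⟩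
  · refine Set.Subset.antisymm ?_ ?_
    · rintro _ ⟨hmem, m, hm, rfl⟩
      by_contra hne
      have hm0 : m ≠ 0 := by
        rintro rfl
        exact hne SystemicRisk.constVec_zero
      obtain ⟨c, hc, hSc⟩ := hSm m hm hm0
      rw [Set.mem_preimage, hSc] at hmem
      have hz : 𝓔.const c ∈ 𝓐 ∩ 𝓔.const '' Set.Iic 0 := ⟨hmem, c, hc.le, rfl⟩
      rw [hA0] at hz
      exact hc.ne (𝓔.eq_zero_of_const_eq_zero hz)
    · rintro _ rfl
      exact ⟨h0, 0, by simp, SystemicRisk.constVec_zero⟩
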